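/- All digraphs are without loops and multiple edges; subdigraphs are full induced subdigraphs. For a vertex $x$ of a digraph $D$ let $D^n(x)$ be the set of vertices reachable from $x$ by a directed walk of length $n$, and let $\mathrm{desc}(x)=\bigcup_{n\ge 0}D^n(x)$. For a set $A$ of vertices of $D$ write $A\le D$ if $\mathrm{desc}(a)\subseteq A$ for all $a\in A$; call such an $A$ finitely generated if $A=\bigcup_{a\in X}\mathrm{desc}(a)$ for some finite $X\subseteq A$. Write $A\le^+D$ if $A\le D$ and, for every vertex $b$ of $D$, (i) if $\mathrm{desc}(b)\setminus A$ is finite then $b\in A$, and (ii) $\mathrm{desc}(b)\cap A$ is finitely generated. Let $\Gamma$ be a digraph with a root $\gamma$ such that: (P0) every vertex of $\Gamma$ lies in $\mathrm{desc}(\gamma)$, all vertices have the same finite out-valency $m>0$, and $\Gamma^s(\gamma)\cap\Gamma^t(\gamma)=\emptyset$ whenever $s\ne t$; (P1) $\mathrm{desc}(u)\cong\Gamma$ for all $u\in\Gamma$; (P2) $\mathrm{desc}(u)\le^+\Gamma$ for all $u\in\Gamma$; (P3) for every $n\ge 0$, $\mathrm{Aut}(\Gamma)$ is transitive on $\Gamma^n(\gamma)$.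 Let $\mathcal C_\Gamma$ be the class of finitely generated digraphs $A$ such that $\mathrm{desc}(a)\le^+A$ and $\mathrm{desc}(a)\cong\Gamma$ for all $a\in A$. Let $D_\Gamma$ be the countable digraph (unique up to isomorphism) with the following properties: (1) $\mathrm{desc}(a)\le^+D_\Gamma$ and $\mathrm{desc}(a)\cong\Gamma$ for all $a\in D_\Gamma$; (2) every finite set of vertices of $D_\Gamma$ is contained in a finitely generated $A\le^+D_\Gamma$ with $A\in\mathcal C_\Gamma$; (3) if $A\le^+D_\Gamma$ is finitely generated, $B\in\mathcal C_\Gamma$ and $f:A\to B$ is a digraph embedding with $f(A)\le^+B$, then there is a digraph embedding $g:B\to D_\Gamma$ with $g(f(a))=a$ for all $a\in A$ and $g(B)\le^+D_\Gamma$. Suppose that $a,b\in D_\Gamma$ are distinct vertices with $a\notin\mathrm{desc}(b)$ and $b\notin\mathrm{desc}(a)$. Then there exist an integer $r\ge 1$ and $g_1,\dots,g_r\in\mathrm{Aut}(D_\Gamma)$ such that, setting $b_0=a$, $b_1=b$ and $b_{i+1}=g_ib_i$ for $1\le i\le r$, we have $g_i b_{i-1}=b_{i-1}$ for $1\le i\le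 r$, and $\mathrm{desc}(b_r)\cap\mathrm{desc}(b_{r+1})=\emptyset$. -/

import Mathlib

universe u v

namespace DescDigraph

/-- The (full) induced subdigraph on a set of vertices. -/
def induce {V : Type u} (D : Digraph V) (A : Set V) : Digraph A where
  Adj x y := D.Adj x y

/-- Digraph isomorphisms. -/
abbrev Iso {V : Type u} {W : Type v} (D : Digraph V) (E : Digraph W) : Type (max u v) :=
  D.Adj ≃r E.Adj

/-- Digraph embeddings: injective maps that preserve and reflect edges, i.e. isomorphisms onto
an induced subdigraph. -/
abbrev Emb {V : Type u} {W : Type v} (D : Digraph V) (E : Digraph W) : Type (max u v) :=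
  D.Adj ↪r E.Adj

/-- The automorphisms of a digraph. -/
abbrev Aut {V : Type u} (D : Digraph V) : Type u := Iso D D

/-- `level D n x` is the set of vertices reachable from `x` by a directed walk of length `n`.
In an asymmetric digraph (no edges in both directions between two vertices, no loops) a walk never
backtracks, so these are the vertices reachable by an `n`-arc; all digraphs considered below are
asymmetric, since condition `P0` rules out directed cycles. -/
def level {V : Type u} (D : Digraph V) : ℕ → V → Set V
  | 0, x => {x}
  | n + 1, x => {z | ∃ y ∈ level D n x, D.Adj y z}

/-- The descendant set of a vertex. -/
def desc {V : Type u} (D : Digraph V) (x : V) : Set V := ⋃ n : ℕ, level D n x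

/-- `A ≤ D`: the set `A` contains all descendants of its elements. -/
def Closed {V : Type u} (D : Digraph V) (A : Set V) : Prop := ∀ a ∈ A, desc D a ⊆ A

/-- `A` is finitely generated: it is the union of the descendant sets of a finite subset. -/
def FinGen {V : Type u} (D : Digraph V) (A : Set V) : Prop :=
  ∃ X : Set V, X.Finite ∧ X ⊆ A ∧ A = ⋃ a ∈ X, desc D a

/-- `A ≤⁺ D`. -/
structure Strong {V : Type u} (D : Digraph V) (A : Set V) : Prop where
  closed : Closed D A
  mem_of_finite : ∀ b : V, (desc D b \ A).Finite → b ∈ A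
  finGen_inter : ∀ b : V, FinGen D (desc D b ∩ A)

/-- Condition P0 for a digraph `Γ` with root `γ`: every vertex is a descendant of `γ`, all vertices
have the same finite non-zero out-valency, and the levels with respect to `γ` are disjoint. -/
structure P0 {V : Type u} (Γ : Digraph V) (γ : V) : Prop where
  rooted : desc Γ γ = Set.univ
  outValency : ∃ m : ℕ, 0 < m ∧ ∀ x : V, {y | Γ.Adj x y}.encard = m
  disjoint : ∀ s t : ℕ, s ≠ t → Disjoint (level Γ s γ) (level Γ t γ)

/-- Condition P1: all descendant sets are isomorphic to `Γ`. -/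
def P1 {V : Type u} (Γ : Digraph V) : Prop :=
  ∀ x : V, Nonempty (Iso (induce Γ (desc Γ x)) Γ)

/-- Condition P2: `desc a ≤⁺ Γ` for every vertex `a`. -/
def P2 {V : Type u} (Γ : Digraph V) : Prop := ∀ a : V, Strong Γ (desc Γ a)

/-- Condition P3: the automorphism group is transitive on each level. -/
def P3 {V : Type u} (Γ : Digraph V) (γ : V) : Prop :=
  ∀ n : ℕ, ∀ x ∈ level Γ n γ, ∀ y ∈ level Γ n γ, ∃ φ : Aut Γ, φ x = y

/-- The class `C̄_Γ` of digraphs `A` such that `desc a ≤⁺ A` and `desc a ≅ Γ` for every `a`. -/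
def InCBar {V : Type u} {W : Type v} (Γ : Digraph V) (A : Digraph W) : Prop :=
  ∀ a : W, Strong A (desc A a) ∧ Nonempty (Iso (induce A (desc A a)) Γ)

/-- The class `C_Γ` of finitely generated members of `C̄_Γ`. -/
def InC {V : Type u} {W : Type v} (Γ : Digraph V) (A : Digraph W) : Prop :=
  InCBar Γ A ∧ FinGen A Set.univ

/-- `D` is the digraph `D_Γ`: the countable digraph determined, up to isomorphism, by these
conditions (the generic or Fraïssé limit of `C_Γ` with respect to `≤⁺`-embeddings). Members of
`C_Γ` are countable, so it does not matter from which universe `B` is taken in `extension`. -/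
structure IsGeneric {V : Type u} {W : Type v} (Γ : Digraph V) (D : Digraph W) : Prop where
  countable : Countable W
  inCBar : ∀ a : W, Strong D (desc D a) ∧ Nonempty (Iso (induce D (desc D a)) Γ)
  exists_finGen : ∀ X : Set W, X.Finite →
    ∃ A : Set W, Strong D A ∧ FinGen D A ∧ X ⊆ A ∧ InC Γ (induce D A)
  extension : ∀ A : Set W, Strong D A → FinGen D A →
    ∀ (U : Type v) (B : Digraph U), InC Γ B →
    ∀ f : Emb (induce D A) B, Strong B (Set.range f) →
    ∃ g : Emb B D, (∀ a : A, g (f a) = a) ∧ Strong D (Set.range g)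

end DescDigraph

namespace DescDigraph

universe w

section Basic

variable {V : Type u} {D : Digraph V}

theorem mem_desc {x y : V} : y ∈ desc D x ↔ ∃ n, y ∈ level D n x := by
  simp [desc]

theorem level_subset_desc (n : ℕ) (x : V) : level D n x ⊆ desc D x :=
  fun _ h => mem_desc.2 ⟨n, h⟩

theorem self_mem_desc (x : V) : x ∈ desc D x := mem_desc.2 ⟨0, rfl⟩

theorem mem_level_add {x : V} {m n : ℕ} {z : V} :
    z ∈ level D (m + n) x ↔ ∃ y ∈ level D m x, z ∈ level D n y := by
  induction n generalizing z with
  | zero =>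
    constructor
    · intro h
      exact ⟨z, h, rfl⟩
    · rintro ⟨y, hy, rfl⟩
      exact hy
  | succ n ih =>
    constructor
    · rintro ⟨t, ht, hz⟩
      obtain ⟨y, hy, hty⟩ := ih.1 ht
      exact ⟨y, hy, t, hty, hz⟩
    · rintro ⟨y, hy, t, ht, hz⟩
      exact ⟨t, ih.2 ⟨y, hy, ht⟩, hz⟩

theorem closed_desc (x : V) : Closed D (desc D x) := by
  intro y hy z hz
  obtain ⟨m, hm⟩ := mem_desc.1 hy
  obtain ⟨n, hn⟩ := mem_desc.1 hz
  exact mem_desc.2 ⟨m + n, mem_level_add.2 ⟨y, hm, hn⟩⟩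

theorem desc_subset_desc {x y : V} (h : y ∈ desc D x) : desc D y ⊆ desc D x :=
  closed_desc x y h

theorem mem_desc_of_adj {x y z : V} (hy : y ∈ desc D x) (h : D.Adj y z) : z ∈ desc D x :=
  closed_desc x y hy (mem_desc.2 ⟨1, y, rfl, h⟩)

theorem closed_of_adj {A : Set V} (h : ∀ a ∈ A, ∀ b, D.Adj a b → b ∈ A) : Closed D A := by
  intro a ha b hb
  obtain ⟨n, hn⟩ := mem_desc.1 hb
  clear hb
  induction n generalizing b with
  | zero =>
    obtain rfl : b = a := hn
    exact ha
  | succ n ih =>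
    obtain ⟨c, hc, hcb⟩ := hn
    exact h c (ih hc) b hcb

theorem Closed.mem_of_adj {A : Set V} (h : Closed D A) {a b : V} (ha : a ∈ A)
    (hab : D.Adj a b) : b ∈ A :=
  h a ha (mem_desc_of_adj (self_mem_desc a) hab)

theorem finGen_biUnion_desc {X : Set V} (hX : X.Finite) : FinGen D (⋃ a ∈ X, desc D a) :=
  ⟨X, hX, fun a ha => Set.mem_biUnion ha (self_mem_desc a), rfl⟩

theorem finGen_desc (x : V) : FinGen D (desc D x) := by
  simpa using finGen_biUnion_desc (D := D) (Set.finite_singleton x)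

theorem FinGen.biUnion {ι : Type*} {X : Set ι} (hX : X.Finite) {F : ι → Set V}
    (hF : ∀ i ∈ X, FinGen D (F i)) : FinGen D (⋃ i ∈ X, F i) := by
  choose! Y hY _ hYF using hF
  have : (⋃ i ∈ X, F i) = ⋃ a ∈ (⋃ i ∈ X, Y i), desc D a := by
    rw [Set.biUnion_iUnion]
    refine Set.iUnion_congr fun i => ?_
    rw [Set.biUnion_iUnion]
    exact Set.iUnion_congr fun hi => hYF i hi
  rw [this]
  exact finGen_biUnion_desc (hX.biUnion hY)

theorem FinGen.union {A B : Set V} (hA : FinGen D A) (hB : FinGen D B) : FinGen D (A ∪ B) := by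
  obtain ⟨X, hX, -, rfl⟩ := hA
  obtain ⟨Y, hY, -, rfl⟩ := hB
  rw [← Set.biUnion_union]
  exact finGen_biUnion_desc (hX.union hY)

end Basic

section Embeddings

variable {V : Type u} {W : Type v} {T : Digraph V} {B : Digraph W}

theorem level_map (f : Emb T B) (hf : Closed B (Set.range f)) (n : ℕ) (x : V) :
    level B n (f x) = f '' level T n x := by
  induction n with
  | zero => simp [level]
  | succ n ih =>
    ext z
    constructor
    · rintro ⟨y, hy, hz⟩
      rw [ih] at hy
      obtain ⟨y, hy, rfl⟩ := hy
      obtain ⟨z, rfl⟩ := hf.mem_of_adj ⟨y, rfl⟩ hz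
      exact ⟨z, ⟨y, hy, f.map_rel_iff.1 hz⟩, rfl⟩
    · rintro ⟨z, ⟨y, hy, hz⟩, rfl⟩
      exact ⟨f y, by rw [ih]; exact ⟨y, hy, rfl⟩, f.map_rel_iff.2 hz⟩

theorem desc_map (f : Emb T B) (hf : Closed B (Set.range f)) (x : V) :
    desc B (f x) = f '' desc T x := by
  simp only [desc, level_map f hf, Set.image_iUnion]

theorem biUnion_desc_map (f : Emb T B) (hf : Closed B (Set.range f)) (X : Set V) :
    ⋃ a ∈ f '' X, desc B a = f '' ⋃ a ∈ X, desc T a := by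
  simp only [Set.biUnion_image, desc_map f hf, Set.image_iUnion]

theorem FinGen.map (f : Emb T B) (hf : Closed B (Set.range f)) {S : Set V} (hS : FinGen T S) :
    FinGen B (f '' S) := by
  obtain ⟨X, hX, -, rfl⟩ := hS
  rw [← biUnion_desc_map f hf]
  exact finGen_biUnion_desc (hX.image f)

theorem FinGen.of_map (f : Emb T B) (hf : Closed B (Set.range f)) {S : Set V}
    (hS : FinGen B (f '' S)) : FinGen T S := by
  obtain ⟨X, hX, hXS, h⟩ := hS
  obtain ⟨Y, hYS, rfl⟩ := Set.subset_image_iff.1 hXS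
  rw [biUnion_desc_map f hf] at h
  rw [f.injective.image_injective h]
  exact finGen_biUnion_desc (hX.of_finite_image f.injective.injOn)

theorem Closed.map {S : Set V} (hS : Closed T S) (f : Emb T B) (hf : Closed B (Set.range f)) :
    Closed B (f '' S) := by
  rintro _ ⟨x, hx, rfl⟩
  rw [desc_map f hf]
  exact Set.image_mono (hS x hx)

theorem Strong.map {S : Set V} (hS : Strong T S) (f : Emb T B) (hf : Strong B (Set.range f)) :
    Strong B (f '' S) where
  closed := hS.closed.map f hf.closed
  mem_of_finite b hb := by
    obtain ⟨x, rfl⟩ := hf.mem_of_finite b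
      (hb.subset (Set.sdiff_subset_sdiff_right (Set.image_subset_range f S)))
    rw [desc_map f hf.closed, ← Set.image_sdiff f.injective] at hb
    exact ⟨x, hS.mem_of_finite x (hb.of_finite_image f.injective.injOn), rfl⟩
  finGen_inter b := by
    obtain ⟨X, hX, hXb, h⟩ := hf.finGen_inter b
    have key : desc B b ∩ f '' S = ⋃ a ∈ X, desc B a ∩ f '' S := by
      rw [← Set.iUnion₂_inter, ← h, Set.inter_assoc,
        Set.inter_eq_self_of_subset_right (Set.image_subset_range f S)]
    rw [key]
    refine FinGen.biUnion hX fun a ha => ?_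
    obtain ⟨x, rfl⟩ := (hXb ha).2
    rw [desc_map f hf.closed, ← Set.image_inter f.injective]
    exact (hS.finGen_inter x).map f hf.closed

theorem Strong.of_map (f : Emb T B) (hf : Closed B (Set.range f)) {S : Set V}
    (hS : Strong B (f '' S)) : Strong T S where
  closed x hx := by
    have := hS.closed (f x) ⟨x, hx, rfl⟩
    rw [desc_map f hf] at this
    exact (Set.image_subset_image_iff f.injective).1 this
  mem_of_finite x hx := by
    have := hS.mem_of_finite (f x) (by
      rw [desc_map f hf, ← Set.image_sdiff f.injective]
      exact hx.image f)
    exact (f.injective.mem_set_image).1 this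
  finGen_inter x := by
    have := hS.finGen_inter (f x)
    rw [desc_map f hf, ← Set.image_inter f.injective] at this
    exact this.of_map f hf

theorem strong_univ : Strong T Set.univ where
  closed _ _ := Set.subset_univ _
  mem_of_finite _ _ := trivial
  finGen_inter b := by simpa using finGen_desc b

/-- The inclusion of an induced subdigraph. -/
def inclusion (B : Digraph W) (A : Set W) : Emb (induce B A) B where
  toFun := Subtype.val
  inj' := Subtype.val_injective
  map_rel_iff' := Iff.rfl

@[simp] theorem range_inclusion (B : Digraph W) (A : Set W) : Set.range (inclusion B A) = A :=
  Subtype.range_val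

/-- An embedding whose image lies in `A`, as an embedding into the subdigraph induced on `A`. -/
def codRestrict (f : Emb T B) (A : Set W) (h : ∀ x, f x ∈ A) : Emb T (induce B A) where
  toFun x := ⟨f x, h x⟩
  inj' _ _ hxy := f.injective (congrArg Subtype.val hxy)
  map_rel_iff' := f.map_rel_iff

theorem strong_range_codRestrict (f : Emb T B) {A : Set W} (hA : Closed B A) (h : ∀ x, f x ∈ A)
    (hf : Strong B (Set.range f)) : Strong (induce B A) (Set.range (codRestrict f A h)) := by
  refine Strong.of_map (inclusion B A) (by simpa using hA) ?_
  rwa [← Set.range_comp]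

end Embeddings

section Amalgam

variable {K : Type u} {V₁ V₂ : Type v} {k : Digraph K} {T₁ : Digraph V₁} {T₂ : Digraph V₂}

/-- `B` is a free amalgam of `T₁` and `T₂` over `k`. -/
structure IsFreeAmalgam {U : Type w} {B : Digraph U} (i₁ : Emb k T₁) (i₂ : Emb k T₂)
    (f₁ : Emb T₁ B) (f₂ : Emb T₂ B) : Prop where
  comm : ∀ z, f₁ (i₁ z) = f₂ (i₂ z)
  exists_of_eq : ∀ x y, f₁ x = f₂ y → ∃ z, x = i₁ z ∧ y = i₂ z
  cover : ∀ b, b ∈ Set.range f₁ ∨ b ∈ Set.range f₂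
  closed_left : Closed B (Set.range f₁)
  closed_right : Closed B (Set.range f₂)

namespace IsFreeAmalgam

variable {U : Type w} {B : Digraph U} {i₁ : Emb k T₁} {i₂ : Emb k T₂}
  {f₁ : Emb T₁ B} {f₂ : Emb T₂ B}

theorem symm (h : IsFreeAmalgam i₁ i₂ f₁ f₂) : IsFreeAmalgam i₂ i₁ f₂ f₁ where
  comm z := (h.comm z).symm
  exists_of_eq x y hxy := by
    obtain ⟨z, hz, hz'⟩ := h.exists_of_eq y x hxy.symm
    exact ⟨z, hz', hz⟩
  cover b := (h.cover b).symm
  closed_left := h.closed_right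
  closed_right := h.closed_left

theorem map_mem_range_iff (h : IsFreeAmalgam i₁ i₂ f₁ f₂) {y : V₂} :
    f₂ y ∈ Set.range f₁ ↔ y ∈ Set.range i₂ := by
  constructor
  · rintro ⟨x, hx⟩
    obtain ⟨z, -, rfl⟩ := h.exists_of_eq x y hx
    exact ⟨z, rfl⟩
  · rintro ⟨z, rfl⟩
    exact ⟨i₁ z, h.comm z⟩

theorem strong_left (h : IsFreeAmalgam i₁ i₂ f₁ f₂) (hi : Strong T₂ (Set.range i₂)) :
    Strong B (Set.range f₁) where
  closed := h.closed_left
  mem_of_finite b hb := by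
    rcases h.cover b with hb' | ⟨y, rfl⟩
    · exact hb'
    · rw [h.map_mem_range_iff]
      refine hi.mem_of_finite y (Set.Finite.of_finite_image (f := f₂) (hb.subset ?_)
        f₂.injective.injOn)
      rintro _ ⟨t, ht, rfl⟩
      rw [desc_map f₂ h.closed_right]
      exact ⟨⟨t, ht.1, rfl⟩, fun h' => ht.2 (h.map_mem_range_iff.1 h')⟩
  finGen_inter b := by
    rcases h.cover b with hb' | ⟨y, rfl⟩
    · rw [Set.inter_eq_self_of_subset_left (h.closed_left b hb')]
      exact finGen_desc b
    · have : desc B (f₂ y) ∩ Set.range f₁ = f₂ '' (desc T₂ y ∩ Set.range i₂) := by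
        rw [desc_map f₂ h.closed_right]
        ext t
        constructor
        · rintro ⟨⟨s, hs, rfl⟩, ht⟩
          exact ⟨s, ⟨hs, h.map_mem_range_iff.1 ht⟩, rfl⟩
        · rintro ⟨s, hs, rfl⟩
          exact ⟨⟨s, hs.1, rfl⟩, h.map_mem_range_iff.2 hs.2⟩
      rw [this]
      exact (hi.finGen_inter y).map f₂ h.closed_right

end IsFreeAmalgam

/-- Isomorphism of descendant sets along an embedding with closed image. -/
theorem nonempty_iso_desc_map {V : Type u} {W : Type v} {T : Digraph V} {B : Digraph W}
    (f : Emb T B) (hf : Closed B (Set.range f)) (x : V) :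
    Nonempty (Iso (induce B (desc B (f x))) (induce T (desc T x))) := by
  rw [desc_map f hf]
  exact ⟨RelIso.symm ⟨Equiv.Set.image f _ f.injective, f.map_rel_iff⟩⟩

theorem InCBar.map {V : Type u} {V' : Type w} {W : Type v} {Γ : Digraph V'} {T : Digraph V}
    {B : Digraph W}
    (hT : InCBar Γ T) (f : Emb T B) (hf : Strong B (Set.range f)) (x : V) :
    Strong B (desc B (f x)) ∧ Nonempty (Iso (induce B (desc B (f x))) Γ) := by
  obtain ⟨hs, ⟨e⟩⟩ := hT x
  obtain ⟨e'⟩ := nonempty_iso_desc_map f hf.closed x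
  refine ⟨?_, ⟨e'.trans e⟩⟩
  rw [desc_map f hf.closed]
  exact hs.map f hf

theorem IsFreeAmalgam.inC {V' : Type*} {Γ : Digraph V'} {U : Type w} {B : Digraph U}
    {i₁ : Emb k T₁} {i₂ : Emb k T₂} {f₁ : Emb T₁ B} {f₂ : Emb T₂ B}
    (h : IsFreeAmalgam i₁ i₂ f₁ f₂)
    (h₁ : Strong T₁ (Set.range i₁)) (h₂ : Strong T₂ (Set.range i₂))
    (hT₁ : InC Γ T₁) (hT₂ : InC Γ T₂) : InC Γ B := by
  constructor
  · intro b
    rcases h.cover b with ⟨x, rfl⟩ | ⟨x, rfl⟩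
    · exact hT₁.1.map f₁ (h.strong_left h₂) x
    · exact hT₂.1.map f₂ (h.symm.strong_left h₁) x
  · have := (hT₁.2.map f₁ h.closed_left).union (hT₂.2.map f₂ h.closed_right)
    rwa [Set.image_univ, Set.image_univ, Set.eq_univ_of_forall (s := Set.range f₁ ∪ Set.range f₂)
      h.cover] at this

open Classical in
theorem exists_isFreeAmalgam (i₁ : Emb k T₁) (i₂ : Emb k T₂)
    (h₁ : Closed T₁ (Set.range i₁)) (h₂ : Closed T₂ (Set.range i₂)) :
    ∃ (U : Type v) (B : Digraph U) (f₁ : Emb T₁ B) (f₂ : Emb T₂ B),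
      IsFreeAmalgam i₁ i₂ f₁ f₂ := by
  let U := V₁ ⊕ {y : V₂ // y ∉ Set.range i₂}
  let j₁ : V₁ → U := Sum.inl
  let j₂ : V₂ → U := fun y => if h : y ∈ Set.range i₂ then Sum.inl (i₁ h.choose) else Sum.inr ⟨y, h⟩
  have hj₁ : Function.Injective j₁ := Sum.inl_injective
  have hcomm : ∀ z, j₂ (i₂ z) = j₁ (i₁ z) := by
    intro z
    have hz : i₂ z ∈ Set.range i₂ := ⟨z, rfl⟩
    simp only [j₂, j₁, dif_pos hz]
    rw [i₂.injective hz.choose_spec]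
  have hinr : ∀ y (h : y ∉ Set.range i₂), j₂ y = Sum.inr ⟨y, h⟩ := fun y h => dif_neg h
  have heq : ∀ x y, j₁ x = j₂ y → ∃ z, x = i₁ z ∧ y = i₂ z := by
    intro x y hxy
    by_cases hy : y ∈ Set.range i₂
    · obtain ⟨z, rfl⟩ := hy
      rw [hcomm] at hxy
      exact ⟨z, hj₁ hxy, rfl⟩
    · rw [hinr y hy] at hxy
      exact absurd hxy (by simp [j₁])
  have hj₂ : Function.Injective j₂ := by
    intro y y' hyy
    by_cases hy : y ∈ Set.range i₂
    · obtain ⟨z, rfl⟩ := hy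
      rw [hcomm] at hyy
      obtain ⟨z', hz', rfl⟩ := heq _ _ hyy
      rw [i₁.injective hz']
    · by_cases hy' : y' ∈ Set.range i₂
      · obtain ⟨z', rfl⟩ := hy'
        rw [hcomm] at hyy
        obtain ⟨z, -, rfl⟩ := heq _ _ hyy.symm
        exact absurd ⟨z, rfl⟩ hy
      · rw [hinr y hy, hinr y' hy'] at hyy
        exact congrArg Subtype.val (Sum.inr_injective hyy)
  let B : Digraph U := ⟨fun a b => (∃ x y, j₁ x = a ∧ j₁ y = b ∧ T₁.Adj x y) ∨
    ∃ x y, j₂ x = a ∧ j₂ y = b ∧ T₂.Adj x y⟩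
  let f₁ : Emb T₁ B := ⟨⟨j₁, hj₁⟩, by
    intro x y
    constructor
    · rintro (⟨x', y', hx, hy, h⟩ | ⟨x', y', hx, hy, h⟩)
      · rwa [← hj₁ hx, ← hj₁ hy]
      · obtain ⟨z, rfl, rfl⟩ := heq _ _ hx.symm
        obtain ⟨z', rfl, rfl⟩ := heq _ _ hy.symm
        exact i₁.map_rel_iff.2 (i₂.map_rel_iff.1 h)
    · exact fun h => Or.inl ⟨x, y, rfl, rfl, h⟩⟩
  let f₂ : Emb T₂ B := ⟨⟨j₂, hj₂⟩, by
    intro x y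
    constructor
    · rintro (⟨x', y', hx, hy, h⟩ | ⟨x', y', hx, hy, h⟩)
      · obtain ⟨z, rfl, rfl⟩ := heq _ _ hx
        obtain ⟨z', rfl, rfl⟩ := heq _ _ hy
        exact i₂.map_rel_iff.2 (i₁.map_rel_iff.1 h)
      · rwa [← hj₂ hx, ← hj₂ hy]
    · exact fun h => Or.inr ⟨x, y, rfl, rfl, h⟩⟩
  refine ⟨U, B, f₁, f₂, fun z => (hcomm z).symm, heq, ?_, closed_of_adj ?_, closed_of_adj ?_⟩
  · rintro (x | ⟨y, hy⟩)
    · exact Or.inl ⟨x, rfl⟩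
    · exact Or.inr ⟨y, hinr y hy⟩
  · rintro _ ⟨x, rfl⟩ b (⟨x', y', hx, rfl, h⟩ | ⟨x', y', hx, rfl, h⟩)
    · exact ⟨y', rfl⟩
    · obtain ⟨z, rfl, rfl⟩ := heq _ _ hx.symm
      obtain ⟨z', rfl⟩ := h₂.mem_of_adj ⟨z, rfl⟩ h
      exact ⟨i₁ z', (hcomm z').symm⟩
  · rintro _ ⟨x, rfl⟩ b (⟨x', y', hx, rfl, h⟩ | ⟨x', y', hx, rfl, h⟩)
    · obtain ⟨z, rfl, rfl⟩ := heq _ _ hx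
      obtain ⟨z', rfl⟩ := h₁.mem_of_adj ⟨z, rfl⟩ h
      exact ⟨i₂ z', hcomm z'⟩
    · exact ⟨y', rfl⟩

end Amalgam

section Homogeneity

variable {W : Type v} {D : Digraph W}

/-- An isomorphism between finitely generated strong subdigraphs, given by its graph. -/
structure IsPartialIso (D : Digraph W) (R : Set (W × W)) : Prop where
  strong_dom : Strong D (Prod.fst '' R)
  finGen_dom : FinGen D (Prod.fst '' R)
  strong_ran : Strong D (Prod.snd '' R)
  finGen_ran : FinGen D (Prod.snd '' R)
  eq_iff : ∀ s ∈ R, ∀ t ∈ R, s.1 = t.1 ↔ s.2 = t.2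
  adj_iff : ∀ s ∈ R, ∀ t ∈ R, D.Adj s.1 t.1 ↔ D.Adj s.2 t.2

theorem IsPartialIso.swap {R : Set (W × W)} (h : IsPartialIso D R) :
    IsPartialIso D (Prod.swap '' R) := by
  have h₁ : Prod.fst '' (Prod.swap '' R) = Prod.snd '' R := by
    rw [Set.image_image]; rfl
  have h₂ : Prod.snd '' (Prod.swap '' R) = Prod.fst '' R := by
    rw [Set.image_image]; rfl
  refine ⟨h₁ ▸ h.strong_ran, h₁ ▸ h.finGen_ran, h₂ ▸ h.strong_dom, h₂ ▸ h.finGen_dom, ?_, ?_⟩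
  · rintro _ ⟨s, hs, rfl⟩ _ ⟨t, ht, rfl⟩
    exact (h.eq_iff s hs t ht).symm
  · rintro _ ⟨s, hs, rfl⟩ _ ⟨t, ht, rfl⟩
    exact (h.adj_iff s hs t ht).symm

theorem isPartialIso_graph {A : Set W} (hA : Strong D A) (hfg : FinGen D A)
    (f : Emb (induce D A) D) (hf : Strong D (Set.range f)) :
    IsPartialIso D (Set.range fun a : A => ((a : W), f a)) := by
  have h₁ : Prod.fst '' (Set.range fun a : A => ((a : W), f a)) = A := by
    rw [← Set.range_comp]
    exact Subtype.range_val
  have h₂ : Prod.snd '' (Set.range fun a : A => ((a : W), f a)) = Set.range f := by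
    rw [← Set.range_comp]
    rfl
  refine ⟨h₁.symm ▸ hA, h₁.symm ▸ hfg, h₂.symm ▸ hf, ?_, ?_, ?_⟩
  · rw [h₂, ← Set.image_univ]
    refine FinGen.map f hf.closed (FinGen.of_map (inclusion D A) ?_ ?_)
    · simpa using hA.closed
    · simpa using hfg
  · rintro _ ⟨s, rfl⟩ _ ⟨t, rfl⟩
    exact Subtype.ext_iff.symm.trans f.injective.eq_iff.symm
  · rintro _ ⟨s, rfl⟩ _ ⟨t, rfl⟩
    exact f.map_rel_iff.symm

theorem IsPartialIso.exists_extend {V : Type u} {Γ : Digraph V} (hD : IsGeneric Γ D)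
    {R : Set (W × W)} (h : IsPartialIso D R) (d : W) :
    ∃ R', IsPartialIso D R' ∧ R ⊆ R' ∧ d ∈ Prod.fst '' R' := by
  obtain ⟨X, hX, hXR, hXeq⟩ := h.finGen_dom
  obtain ⟨C, hC, hCfg, hXC, hCΓ⟩ := hD.exists_finGen (insert d X) (hX.insert d)
  have hRC : Prod.fst '' R ⊆ C := by
    rw [hXeq]
    exact Set.iUnion₂_subset fun a ha => hC.closed a (hXC (Set.mem_insert_of_mem d ha))
  choose s hsR hs using fun y : Prod.snd '' R => y.2
  have hmemC : ∀ y, (s y).1 ∈ C := fun y => hRC ⟨s y, hsR y, rfl⟩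
  let f : Emb (induce D (Prod.snd '' R)) D := ⟨⟨fun y => (s y).1, fun y z hyz => Subtype.ext <| by
      rw [← hs y, ← hs z]
      exact (h.eq_iff _ (hsR y) _ (hsR z)).1 hyz⟩, fun {y z} => by
      refine (h.adj_iff _ (hsR y) _ (hsR z)).trans ?_
      rw [hs y, hs z]
      rfl⟩
  have hsf : ∀ p (hp : p ∈ R), f ⟨p.2, p, hp, rfl⟩ = p.1 := fun p hp =>
    (h.eq_iff _ (hsR _) _ hp).2 (hs _)
  have hrange : Set.range f = Prod.fst '' R := by
    ext x
    constructor
    · rintro ⟨y, rfl⟩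
      exact ⟨s y, hsR y, rfl⟩
    · rintro ⟨p, hp, rfl⟩
      exact ⟨_, hsf p hp⟩
  obtain ⟨g, hgf, hg⟩ := hD.extension _ h.strong_ran h.finGen_ran C (induce D C) hCΓ
    (codRestrict f C hmemC) (strong_range_codRestrict f hC.closed hmemC (hrange ▸ h.strong_dom))
  refine ⟨_, isPartialIso_graph hC hCfg g hg, ?_, ?_⟩
  · intro p hp
    refine ⟨⟨p.1, hRC ⟨p, hp, rfl⟩⟩, Prod.ext rfl ?_⟩
    have := hgf ⟨p.2, p, hp, rfl⟩
    rw [show codRestrict f C hmemC ⟨p.2, p, hp, rfl⟩ = ⟨p.1, hRC ⟨p, hp, rfl⟩⟩ from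
      Subtype.ext (hsf p hp)] at this
    exact this
  · exact ⟨_, ⟨⟨d, hXC (Set.mem_insert d X)⟩, rfl⟩, rfl⟩

theorem IsPartialIso.exists_extend_ran {V : Type u} {Γ : Digraph V} (hD : IsGeneric Γ D)
    {R : Set (W × W)} (h : IsPartialIso D R) (d : W) :
    ∃ R', IsPartialIso D R' ∧ R ⊆ R' ∧ d ∈ Prod.snd '' R' := by
  obtain ⟨R', hR', hRR', p, hp, rfl⟩ := h.swap.exists_extend hD d
  refine ⟨Prod.swap '' R', hR'.swap, fun q hq => ⟨q.swap, hRR' ⟨q, hq, rfl⟩, q.swap_swap⟩,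
    p.swap, ⟨p, hp, rfl⟩, rfl⟩

/-- A partial isomorphism of the generic digraph extends to an automorphism. -/
theorem IsPartialIso.exists_aut {V : Type u} {Γ : Digraph V} (hD : IsGeneric Γ D)
    {R : Set (W × W)} (h : IsPartialIso D R) : ∃ g : Aut D, ∀ p ∈ R, g p.1 = p.2 := by
  have := hD.countable
  let _ : Encodable W := Encodable.ofCountable W
  let P := {R : Set (W × W) // IsPartialIso D R}
  let 𝒟 : W ⊕ W → Order.Cofinal P := Sum.elim
    (fun d => ⟨{R | d ∈ Prod.fst '' R.1}, fun R => by
      obtain ⟨R', hR', hle, hd⟩ := R.2.exists_extend hD d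
      exact ⟨⟨R', hR'⟩, hd, hle⟩⟩)
    (fun d => ⟨{R | d ∈ Prod.snd '' R.1}, fun R => by
      obtain ⟨R', hR', hle, hd⟩ := R.2.exists_extend_ran hD d
      exact ⟨⟨R', hR'⟩, hd, hle⟩⟩)
  let J := Order.idealOfCofinals (⟨R, h⟩ : P) 𝒟
  have hpair : ∀ S ∈ J, ∀ S' ∈ J, ∀ s ∈ S.1, ∀ t ∈ S'.1,
      (s.1 = t.1 ↔ s.2 = t.2) ∧ (D.Adj s.1 t.1 ↔ D.Adj s.2 t.2) := by
    intro S hS S' hS' s hs t ht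
    obtain ⟨S'', -, hle, hle'⟩ := J.directed S hS S' hS'
    exact ⟨S''.2.eq_iff s (hle hs) t (hle' ht), S''.2.adj_iff s (hle hs) t (hle' ht)⟩
  have hdom : ∀ x, ∃ y, ∃ S ∈ J, (x, y) ∈ S.1 := by
    intro x
    obtain ⟨S, ⟨⟨_, y⟩, hp, rfl⟩, hSJ⟩ :=
      Order.cofinal_meets_idealOfCofinals (⟨R, h⟩ : P) 𝒟 (Sum.inl x)
    exact ⟨y, S, hSJ, hp⟩
  have hran : ∀ y, ∃ x, ∃ S ∈ J, (x, y) ∈ S.1 := by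
    intro y
    obtain ⟨S, ⟨⟨x, _⟩, hp, rfl⟩, hSJ⟩ :=
      Order.cofinal_meets_idealOfCofinals (⟨R, h⟩ : P) 𝒟 (Sum.inr y)
    exact ⟨x, S, hSJ, hp⟩
  choose φ S hS hφ using hdom
  choose ψ S' hS' hψ using hran
  refine ⟨⟨⟨φ, ψ, fun x => ?_, fun y => ?_⟩, fun {x y} => ?_⟩, fun p hp => ?_⟩
  · exact ((hpair _ (hS' (φ x)) _ (hS x) _ (hψ (φ x)) _ (hφ x)).1).2 rfl
  · exact ((hpair _ (hS (ψ y)) _ (hS' y) _ (hφ (ψ y)) _ (hψ y)).1).1 rfl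
  · exact ((hpair _ (hS x) _ (hS y) _ (hφ x) _ (hφ y)).2).symm
  · exact ((hpair _ (hS p.1) _ (Order.mem_idealOfCofinals (⟨R, h⟩ : P) 𝒟) _ (hφ p.1) _ hp).1).1
      rfl

theorem IsGeneric.exists_aut_extending {V : Type u} {Γ : Digraph V} (hD : IsGeneric Γ D)
    {A : Set W} (hA : Strong D A) (hfg : FinGen D A) (f : Emb (induce D A) D)
    (hf : Strong D (Set.range f)) : ∃ g : Aut D, ∀ a : A, g a = f a := by
  obtain ⟨g, hg⟩ := (isPartialIso_graph hA hfg f hf).exists_aut hD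
  exact ⟨g, fun a => hg _ ⟨a, rfl⟩⟩

/-- Twisting the free amalgam of two copies of a subdigraph over `desc p` by an automorphism of
`desc p` yields an automorphism of the generic digraph. -/
theorem IsGeneric.exists_aut_desc_inter_subset {V : Type u} {Γ : Digraph V}
    (hD : IsGeneric Γ D) (p q : W) (f : Emb Γ D) (hf : Set.range f = desc D p) (ψ : Aut Γ) :
    ∃ g : Aut D, (∀ w, g (f (ψ w)) = f w) ∧ desc D q ∩ desc D (g q) ⊆ desc D p := by
  obtain ⟨A, hA, hAfg, hXA, hAΓ⟩ := hD.exists_finGen {p, q} (by simp)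
  have hpA : p ∈ A := hXA (by simp)
  have hqA : q ∈ A := hXA (by simp)
  have hfA : ∀ w, f w ∈ A := fun w => hA.closed p hpA (hf ▸ ⟨w, rfl⟩)
  let f' : Emb Γ D := ψ.toRelEmbedding.trans f
  have hf' : Set.range f' = Set.range f := ψ.surjective.range_comp f
  have hfA' : ∀ w, f' w ∈ A := fun w => hfA (ψ w)
  have hfs : Strong D (Set.range f) := hf ▸ (hD.inCBar p).1
  have hs₁ := strong_range_codRestrict f hA.closed hfA hfs
  have hs₂ := strong_range_codRestrict f' hA.closed hfA' (hf' ▸ hfs)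
  obtain ⟨U, B, f₁, f₂, hB⟩ := exists_isFreeAmalgam (codRestrict f A hfA) (codRestrict f' A hfA')
    hs₁.closed hs₂.closed
  obtain ⟨h, hh, hhs⟩ := hD.extension A hA hAfg U B (hB.inC hs₁ hs₂ hAΓ hAΓ) f₁
    (hB.strong_left hs₂)
  have hrange : Strong D (Set.range (f₂.trans h)) := by
    have := (hB.symm.strong_left hs₁).map h hhs
    rwa [← Set.range_comp] at this
  obtain ⟨g, hg⟩ := hD.exists_aut_extending hA hAfg (f₂.trans h) hrange
  refine ⟨g, fun w => ?_, ?_⟩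
  · rw [show f (ψ w) = codRestrict f' A hfA' w from rfl, hg, RelEmbedding.trans_apply,
      ← hB.comm, hh]
    rfl
  · rintro z ⟨hzq, hz⟩
    have hzA : z ∈ A := hA.closed q hqA hzq
    have hz' : z ∈ Set.range (f₂.trans h) := hrange.closed (g q) ⟨⟨q, hqA⟩, (hg ⟨q, hqA⟩).symm⟩ hz
    obtain ⟨t, rfl⟩ := hz'
    have := hh ⟨_, hzA⟩
    obtain ⟨w, hw, -⟩ := hB.exists_of_eq _ _ (h.injective this)
    rw [← hf]
    exact ⟨w, (congrArg Subtype.val hw).symm⟩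

end Homogeneity

section Rooted

variable {V : Type u} {Γ : Digraph V} {γ : V}

theorem P0.exists_level (h0 : P0 Γ γ) (x : V) : ∃ n, x ∈ level Γ n γ :=
  mem_desc.1 (h0.rooted.symm ▸ Set.mem_univ x)

theorem P0.level_unique (h0 : P0 Γ γ) {x : V} {s t : ℕ} (hs : x ∈ level Γ s γ)
    (ht : x ∈ level Γ t γ) : s = t := by
  by_contra hst
  exact Set.disjoint_left.1 (h0.disjoint s t hst) hs ht

theorem P0.exists_adj (h0 : P0 Γ γ) (x : V) : ∃ y, Γ.Adj x y := by
  obtain ⟨m, hm, h⟩ := h0.outValency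
  have : {y | Γ.Adj x y}.Nonempty := by
    rw [← Set.encard_pos, h x]
    exact_mod_cast hm
  exact this

theorem P0.level_nonempty (h0 : P0 Γ γ) (x : V) (n : ℕ) : (level Γ n x).Nonempty := by
  induction n with
  | zero => exact ⟨x, rfl⟩
  | succ n ih =>
    obtain ⟨y, hy⟩ := ih
    obtain ⟨z, hz⟩ := h0.exists_adj y
    exact ⟨z, y, hy, hz⟩

theorem P0.level_finite (h0 : P0 Γ γ) (x : V) (n : ℕ) : (level Γ n x).Finite := by
  induction n with
  | zero => exact Set.finite_singleton x
  | succ n ih =>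
    obtain ⟨m, -, h⟩ := h0.outValency
    have : level Γ (n + 1) x = ⋃ y ∈ level Γ n x, {z | Γ.Adj y z} := by
      ext z
      simp [level]
    rw [this]
    exact ih.biUnion fun y _ => Set.finite_of_encard_eq_coe (h y)

theorem P0.eq_root (h0 : P0 Γ γ) {x : V} (hx : desc Γ x = Set.univ) : x = γ := by
  obtain ⟨s, hs⟩ := mem_desc.1 (hx.symm ▸ Set.mem_univ γ : γ ∈ desc Γ x)
  obtain ⟨t, ht⟩ := h0.exists_level x
  have h := h0.level_unique (t := 0) (mem_level_add.2 ⟨x, ht, hs⟩) rfl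
  obtain rfl : t = 0 := by omega
  exact ht

theorem P0.aut_root (h0 : P0 Γ γ) (ψ : Aut Γ) : ψ γ = γ := by
  refine h0.eq_root ?_
  have hψ : Set.range ψ.toRelEmbedding = Set.univ := ψ.surjective.range_eq
  have := desc_map ψ.toRelEmbedding (by rw [hψ]; exact strong_univ.closed) γ
  rw [h0.rooted, Set.image_univ, hψ] at this
  exact this

/-- A descendant set isomorphic to `Γ` is the image of an embedding that maps the root to the
generating vertex. -/
theorem P0.exists_emb_desc (h0 : P0 Γ γ) {W : Type v} {D : Digraph W} {b : W}
    (e : Iso (induce D (desc D b)) Γ) :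
    ∃ f : Emb Γ D, Set.range f = desc D b ∧ f γ = b := by
  let f : Emb Γ D := e.symm.toRelEmbedding.trans (inclusion D (desc D b))
  have hf : Set.range f = desc D b :=
    (e.symm.surjective.range_comp (inclusion D (desc D b))).trans (range_inclusion D _)
  refine ⟨f, hf, ?_⟩
  obtain ⟨x, hx⟩ : b ∈ Set.range f := hf ▸ self_mem_desc b
  have := desc_map f (by rw [hf]; exact closed_desc b) x
  rw [hx, ← hf, ← Set.image_univ] at this
  rw [← h0.eq_root (f.injective.image_injective this).symm, hx]

/-- The number of in-neighbours. -/
noncomputable def inDegree (Γ : Digraph V) (z : V) : ℕ := {v | Γ.Adj v z}.ncard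

theorem P0.mem_level_of_adj (h0 : P0 Γ γ) {v z : V} {n : ℕ} (hz : z ∈ level Γ (n + 1) γ)
    (h : Γ.Adj v z) : v ∈ level Γ n γ := by
  obtain ⟨t, ht⟩ := h0.exists_level v
  obtain rfl : t = n := by
    have := h0.level_unique (s := t + 1) ⟨v, ht, h⟩ hz
    omega
  exact ht

theorem P0.finite_inNeighbors (h0 : P0 Γ γ) (z : V) : {v | Γ.Adj v z}.Finite := by
  obtain ⟨n, hn⟩ := h0.exists_level z
  cases n with
  | zero =>
    convert Set.finite_empty
    refine Set.eq_empty_of_forall_notMem fun v hv => ?_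
    obtain ⟨t, ht⟩ := h0.exists_level v
    exact absurd (h0.level_unique (s := t + 1) ⟨v, ht, hv⟩ hn) (by omega)
  | succ n =>
    exact (h0.level_finite γ n).subset fun v hv => h0.mem_level_of_adj hn hv

theorem inDegree_eq_of_mem_level (h3 : P3 Γ γ) {n : ℕ} {y z : V} (hy : y ∈ level Γ n γ)
    (hz : z ∈ level Γ n γ) : inDegree Γ y = inDegree Γ z := by
  obtain ⟨φ, rfl⟩ := h3 n y hy z hz
  have : {v | Γ.Adj v (φ y)} = φ '' {v | Γ.Adj v y} := by
    ext v
    obtain ⟨v, rfl⟩ := φ.surjective v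
    simp [φ.map_rel_iff]
  rw [inDegree, inDegree, this, Set.ncard_image_of_injective _ φ.injective]

theorem P0.exists_inDegree_le (h0 : P0 Γ γ) (h3 : P3 Γ γ) :
    ∃ m : ℕ, ∀ s, ∃ t, s ≤ t ∧ ∀ z ∈ level Γ t γ, inDegree Γ z ≤ m := by
  classical
  obtain ⟨m, hm, hout⟩ := h0.outValency
  refine ⟨m, fun s => ?_⟩
  by_contra! hcon
  have hdeg : ∀ t, s ≤ t → ∀ z ∈ level Γ t γ, m + 1 ≤ inDegree Γ z := by
    intro t ht z hz
    obtain ⟨z', hz', h⟩ := hcon t ht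
    rwa [inDegree_eq_of_mem_level h3 hz hz']
  have hlt : ∀ t, s ≤ t → (level Γ (t + 1) γ).ncard < (level Γ t γ).ncard := by
    intro t ht
    have hF := h0.level_finite γ t
    have hF' := h0.level_finite γ (t + 1)
    have key : hF'.toFinset.card * (m + 1) ≤ hF.toFinset.card * m := by
      refine Finset.card_mul_le_card_mul (fun z v => Γ.Adj v z) ?_ ?_
      · intro z hz
        rw [Set.Finite.mem_toFinset] at hz
        refine (hdeg (t + 1) (by omega) z hz).trans ?_
        rw [inDegree, ← Set.ncard_coe_finset]
        refine Set.ncard_le_ncard (fun v hv => ?_) (Finset.finite_toSet _)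
        simpa [Finset.bipartiteAbove] using ⟨h0.mem_level_of_adj hz hv, hv⟩
      · intro v _
        have h1 : {y | Γ.Adj v y}.ncard = m := by rw [Set.ncard, hout v]; rfl
        rw [← h1, ← Set.ncard_coe_finset]
        refine Set.ncard_le_ncard (fun z hz => ?_) (Set.finite_of_encard_eq_coe (hout v))
        have := (Finset.mem_filter.1 (Finset.mem_coe.1 hz)).2
        exact this
    rw [← Set.ncard_eq_toFinset_card _ hF, ← Set.ncard_eq_toFinset_card _ hF'] at key
    have hpos : 0 < (level Γ t γ).ncard := (Set.ncard_pos hF).2 (h0.level_nonempty γ t)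
    by_contra! hle
    have := Nat.mul_le_mul_right m hle
    rw [Nat.mul_succ] at key
    omega
  have hbound : ∀ k, (level Γ (s + k) γ).ncard + k ≤ (level Γ s γ).ncard := by
    intro k
    induction k with
    | zero => simp
    | succ k ih =>
      have := hlt (s + k) (by omega)
      rw [← Nat.add_assoc s k 1]
      omega
  have := hbound ((level Γ s γ).ncard + 1)
  omega

/-- Deep inside `desc x` all in-neighbours are themselves descendants of `x`. -/
theorem P0.exists_inNeighbor_mem_desc (h0 : P0 Γ γ) (h1 : P1 Γ) (h3 : P3 Γ γ) :
    ∃ s₀ : ℕ, ∀ x s z v, s₀ ≤ s → z ∈ level Γ s x → Γ.Adj v z → v ∈ desc Γ x := by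
  choose r hr using h0.level_nonempty γ
  have hpr : ∀ n z, z ∈ level Γ n γ → inDegree Γ z = inDegree Γ (r n) := fun n z hz =>
    inDegree_eq_of_mem_level h3 hz (hr n)
  have hshift : ∀ x, ∃ f : Emb Γ Γ, Set.range f = desc Γ x ∧ f γ = x := fun x =>
    h0.exists_emb_desc (h1 x).some
  have hle : ∀ (f : Emb Γ Γ) w, f '' {v | Γ.Adj v w} ⊆ {v | Γ.Adj v (f w)} := by
    rintro f w _ ⟨v, hv, rfl⟩
    exact f.map_rel_iff.2 hv
  have hcard : ∀ (f : Emb Γ Γ) w, (f '' {v | Γ.Adj v w}).ncard = inDegree Γ w := fun f w =>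
    Set.ncard_image_of_injective _ f.injective
  have hlevel : ∀ (f : Emb Γ Γ) x, Set.range f = desc Γ x → f γ = x → ∀ n s w,
      x ∈ level Γ n γ → w ∈ level Γ s γ → f w ∈ level Γ (n + s) γ := by
    intro f x hf hfx n s w hx hw
    refine mem_level_add.2 ⟨x, hx, ?_⟩
    rw [← hfx, level_map f (by rw [hf]; exact closed_desc x)]
    exact ⟨w, hw, rfl⟩
  have hmono : Monotone fun n => inDegree Γ (r n) := by
    intro s t hst
    obtain ⟨n, rfl⟩ := Nat.exists_eq_add_of_le' hst
    obtain ⟨f, hf, hfx⟩ := hshift (r n)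
    change inDegree Γ (r s) ≤ inDegree Γ (r (n + s))
    rw [← hpr _ _ (hlevel f _ hf hfx n s _ (hr n) (hr s)), ← hcard f]
    exact Set.ncard_le_ncard (hle f _) (h0.finite_inNeighbors _)
  obtain ⟨m, hm⟩ := h0.exists_inDegree_le h3
  have hbdd : BddAbove (Set.range fun n => inDegree Γ (r n)) := by
    refine ⟨m, ?_⟩
    rintro _ ⟨s, rfl⟩
    obtain ⟨t, hst, ht⟩ := hm s
    exact (hmono hst).trans (ht _ (hr t))
  obtain ⟨s₀, hs₀⟩ := Nat.sSup_mem (Set.range_nonempty _) hbdd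
  have hmax : ∀ t, inDegree Γ (r t) ≤ inDegree Γ (r s₀) := fun t =>
    (le_csSup hbdd ⟨t, rfl⟩).trans hs₀.ge
  refine ⟨s₀, fun x s z v hs hz hvz => ?_⟩
  obtain ⟨n, hx⟩ := h0.exists_level x
  obtain ⟨f, hf, hfx⟩ := hshift x
  rw [← hfx, level_map f (by rw [hf]; exact closed_desc x)] at hz
  obtain ⟨w, hw, rfl⟩ := hz
  have heq : f '' {v | Γ.Adj v w} = {v | Γ.Adj v (f w)} := by
    refine Set.eq_of_subset_of_ncard_le (hle f w) ?_ (h0.finite_inNeighbors _)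
    rw [hcard, hpr s w hw]
    change inDegree Γ (f w) ≤ _
    rw [hpr _ _ (hlevel f x hf hfx n s w hx hw)]
    exact (hmax _).trans (hmono hs)
  have hv : v ∈ f '' {v | Γ.Adj v w} := heq ▸ hvz
  rw [← hf]
  exact Set.image_subset_range _ _ hv

end Rooted

section Generic

variable {V : Type u} {W : Type v} {Γ : Digraph V} {γ : V} {D : Digraph W}

theorem IsGeneric.exists_emb (hD : IsGeneric Γ D) (h0 : P0 Γ γ) (b : W) :
    ∃ f : Emb Γ D, Set.range f = desc D b ∧ (∀ n x, level D n (f x) = f '' level Γ n x) ∧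
      f γ = b := by
  obtain ⟨f, hf, hfb⟩ := h0.exists_emb_desc (hD.inCBar b).2.some
  exact ⟨f, hf, fun n x => level_map f (by rw [hf]; exact closed_desc b) n x, hfb⟩

theorem IsGeneric.level_unique (hD : IsGeneric Γ D) (h0 : P0 Γ γ) {b x : W} {s t : ℕ}
    (hs : x ∈ level D s b) (ht : x ∈ level D t b) : s = t := by
  obtain ⟨f, -, hl, rfl⟩ := hD.exists_emb h0 b
  rw [hl] at hs ht
  obtain ⟨y, hy, rfl⟩ := hs
  exact h0.level_unique hy (f.injective.mem_set_image.1 ht)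

theorem IsGeneric.level_finite (hD : IsGeneric Γ D) (h0 : P0 Γ γ) (b : W) (n : ℕ) :
    (level D n b).Finite := by
  obtain ⟨f, -, hl, rfl⟩ := hD.exists_emb h0 b
  rw [hl]
  exact (h0.level_finite γ n).image f

theorem IsGeneric.level_nonempty (hD : IsGeneric Γ D) (h0 : P0 Γ γ) (b : W) (n : ℕ) :
    (level D n b).Nonempty := by
  obtain ⟨f, -, hl, rfl⟩ := hD.exists_emb h0 b
  rw [hl]
  exact (h0.level_nonempty γ n).image f

theorem IsGeneric.exists_inNeighbor_mem_desc (hD : IsGeneric Γ D) (h0 : P0 Γ γ) (h1 : P1 Γ)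
    (h3 : P3 Γ γ) : ∃ s₀ : ℕ, ∀ b, ∀ x ∈ desc D b, ∀ s z, ∀ v ∈ desc D b, s₀ ≤ s →
      z ∈ level D s x → D.Adj v z → v ∈ desc D x := by
  obtain ⟨s₀, hs₀⟩ := h0.exists_inNeighbor_mem_desc h1 h3
  refine ⟨s₀, fun b x hx s z v hv hs hz hvz => ?_⟩
  obtain ⟨f, hf, hl, -⟩ := hD.exists_emb h0 b
  rw [← hf] at hx hv
  obtain ⟨x, rfl⟩ := hx
  obtain ⟨v, rfl⟩ := hv
  rw [hl] at hz
  obtain ⟨z, hz, rfl⟩ := hz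
  rw [desc_map f (by rw [hf]; exact closed_desc b)]
  exact ⟨v, hs₀ x s z v hs hz (f.map_rel_iff.1 hvz), rfl⟩

theorem aut_mem_level_iff (g : Aut D) {n : ℕ} {x y : W} :
    g y ∈ level D n (g x) ↔ y ∈ level D n x := by
  have hg : Set.range g.toRelEmbedding = Set.univ := g.surjective.range_eq
  have := level_map g.toRelEmbedding (by rw [hg]; exact strong_univ.closed) n x
  change level D n (g x) = g '' level D n x at this
  rw [this, g.injective.mem_set_image]

theorem aut_mem_desc_iff (g : Aut D) {x y : W} : g y ∈ desc D (g x) ↔ y ∈ desc D x := by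
  simp only [mem_desc, aut_mem_level_iff]

/-- Incomparable vertices `p`, `q` such that `desc p` and `desc q` induce the same levels on their
intersection, and the intersection is closed under in-neighbours beyond level `N`. -/
structure Balanced (D : Digraph W) (N : ℕ) (p q : W) : Prop where
  notMem : p ∉ desc D q
  notMem' : q ∉ desc D p
  level_iff : ∀ n z, z ∈ desc D p → z ∈ desc D q → (z ∈ level D n p ↔ z ∈ level D n q)
  mem_of_adj : ∀ n v z, N ≤ n → v ∈ level D n p → D.Adj v z → z ∈ desc D q → v ∈ desc D q
  mem_of_adj' : ∀ n v z, N ≤ n → v ∈ level D n q → D.Adj v z → z ∈ desc D p → v ∈ desc D p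

theorem notMem_desc_of_inter_subset {p q : W} (g : Aut D) (hgp : g p = p)
    (hsub : desc D q ∩ desc D (g q) ⊆ desc D p) (hq : q ∉ desc D p) :
    q ∉ desc D (g q) ∧ g q ∉ desc D q := by
  refine ⟨fun h => hq (hsub ⟨self_mem_desc q, h⟩), fun h => hq ?_⟩
  have := hsub ⟨h, self_mem_desc _⟩
  rwa [← hgp, aut_mem_desc_iff] at this

theorem IsGeneric.exists_balanced (hD : IsGeneric Γ D) (h0 : P0 Γ γ) (h1 : P1 Γ) (h3 : P3 Γ γ)
    {p q : W} (hq : q ∉ desc D p) :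
    ∃ (g : Aut D) (N : ℕ), g p = p ∧ Balanced D N q (g q) := by
  obtain ⟨f, hf, -, hfp⟩ := hD.exists_emb h0 p
  obtain ⟨g, hg, hsub⟩ := hD.exists_aut_desc_inter_subset p q f hf (RelIso.refl _)
  have hfix : ∀ z ∈ desc D p, g z = z := by
    intro z hz
    rw [← hf] at hz
    obtain ⟨w, rfl⟩ := hz
    exact hg w
  have hgp : g p = p := hfix p (self_mem_desc p)
  have hlev : ∀ n z, z ∈ desc D q → z ∈ desc D (g q) →
      (z ∈ level D n q ↔ z ∈ level D n (g q)) := by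
    intro n z hz hz'
    nth_rw 2 [← hfix z (hsub ⟨hz, hz'⟩)]
    exact (aut_mem_level_iff g).symm
  obtain ⟨s₀, hs₀⟩ := hD.exists_inNeighbor_mem_desc h0 h1 h3
  obtain ⟨X, hX, hXsub, hXeq⟩ := (hD.inCBar (g q)).1.finGen_inter q
  have hlX : ∀ x, ∃ n, x ∈ X → x ∈ level D n q := by
    intro x
    by_cases hx : x ∈ X
    · obtain ⟨n, hn⟩ := mem_desc.1 (hXsub hx).1
      exact ⟨n, fun _ => hn⟩
    · exact ⟨0, fun h => absurd h hx⟩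
  choose l hl using hlX
  obtain ⟨M, hM⟩ := (hX.image l).bddAbove
  have key : ∀ b n v z, (∀ x ∈ X, x ∈ level D (l x) b) → M + s₀ ≤ n → v ∈ level D n b →
      D.Adj v z → z ∈ desc D q ∩ desc D (g q) → v ∈ desc D q ∩ desc D (g q) := by
    intro b n v z hb hn hv hvz hz
    rw [hXeq] at hz ⊢
    obtain ⟨x, hx, hzx⟩ := Set.mem_iUnion₂.1 hz
    obtain ⟨k, hk⟩ := mem_desc.1 hzx
    have h := hD.level_unique h0 (t := n + 1) (mem_level_add.2 ⟨x, hb x hx, hk⟩) ⟨v, hv, hvz⟩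
    have hxM : l x ≤ M := hM ⟨x, hx, rfl⟩
    exact Set.mem_iUnion₂.2 ⟨x, hx, hs₀ b x (level_subset_desc _ _ (hb x hx)) k z v
      (level_subset_desc _ _ hv) (by omega) hk hvz⟩
  have hne := notMem_desc_of_inter_subset g hgp hsub hq
  refine ⟨g, M + s₀, hgp, hne.1, hne.2, hlev, ?_, ?_⟩
  · intro n v z hn hv hvz hz
    exact (key q n v z hl hn hv hvz ⟨mem_desc_of_adj (level_subset_desc _ _ hv) hvz, hz⟩).2
  · intro n v z hn hv hvz hz
    refine (key (g q) n v z (fun x hx => ?_) hn hv hvz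
      ⟨hz, mem_desc_of_adj (level_subset_desc _ _ hv) hvz⟩).1
    exact (hlev _ _ (hXsub hx).1 (hXsub hx).2).1 (hl x hx)

theorem Balanced.next {N : ℕ} {p q : W} (h : Balanced D N p q) (g : Aut D) (hgp : g p = p)
    (hsub : desc D q ∩ desc D (g q) ⊆ desc D p) : Balanced D N q (g q) := by
  have hne := notMem_desc_of_inter_subset g hgp hsub h.notMem'
  have hlp : ∀ n y, g y ∈ level D n p ↔ y ∈ level D n p := fun n y => by
    nth_rw 1 [← hgp]
    exact aut_mem_level_iff g
  have hdp : ∀ y, g y ∈ desc D p ↔ y ∈ desc D p := fun y => by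
    nth_rw 1 [← hgp]
    exact aut_mem_desc_iff g
  refine ⟨hne.1, hne.2, ?_, ?_, ?_⟩
  · intro n z hz hz'
    have hzp := hsub ⟨hz, hz'⟩
    obtain ⟨y, rfl⟩ := g.surjective z
    rw [aut_mem_desc_iff] at hz'
    rw [← h.level_iff n _ hzp hz, hlp, aut_mem_level_iff, h.level_iff n y ((hdp y).1 hzp) hz']
  · intro n v z hn hv hvz hz
    have hzp := hsub ⟨mem_desc_of_adj (level_subset_desc _ _ hv) hvz, hz⟩
    have hvp : v ∈ desc D p := h.mem_of_adj' n v z hn hv hvz hzp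
    have hvn : v ∈ level D n p := (h.level_iff n v hvp (level_subset_desc _ _ hv)).2 hv
    obtain ⟨y, rfl⟩ := g.surjective z
    obtain ⟨w, rfl⟩ := g.surjective v
    rw [aut_mem_desc_iff] at hz ⊢
    exact h.mem_of_adj n w y hn ((hlp n w).1 hvn) (g.map_rel_iff.1 hvz) hz
  · intro n v z hn hv hvz hz
    have hzp := hsub ⟨hz, mem_desc_of_adj (level_subset_desc _ _ hv) hvz⟩
    obtain ⟨y, rfl⟩ := g.surjective z
    obtain ⟨w, rfl⟩ := g.surjective v
    rw [aut_mem_level_iff] at hv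
    have hwp : w ∈ desc D p := h.mem_of_adj' n w y hn hv (g.map_rel_iff.1 hvz) ((hdp y).1 hzp)
    have hwn : w ∈ level D n p := (h.level_iff n w hwp (level_subset_desc _ _ hv)).2 hv
    exact h.mem_of_adj n _ _ hn ((hlp n w).2 hwn) hvz hz

theorem IsGeneric.disjoint_of_level_inter_eq_empty (hD : IsGeneric Γ D) (h0 : P0 Γ γ) {N : ℕ}
    {p q : W} (h : Balanced D N p q) (hN : level D N p ∩ desc D q = ∅) :
    Disjoint (desc D p) (desc D q) := by
  have hge : ∀ k z, z ∈ level D (N + k) p → z ∉ desc D q := by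
    intro k
    induction k with
    | zero => exact fun z hz hz' => Set.eq_empty_iff_forall_notMem.1 hN z ⟨hz, hz'⟩
    | succ k ih =>
      rintro z ⟨v, hv, hvz⟩ hz'
      exact ih v hv (h.mem_of_adj _ v z (Nat.le_add_right N k) hv hvz hz')
  refine Set.disjoint_left.2 fun z hz hz' => ?_
  obtain ⟨k, hk⟩ := mem_desc.1 hz
  obtain ⟨y, hy⟩ := hD.level_nonempty h0 z N
  refine hge k y ?_ (desc_subset_desc hz' (level_subset_desc _ _ hy))
  rw [Nat.add_comm]
  exact mem_level_add.2 ⟨z, hk, hy⟩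

theorem IsGeneric.exists_mem_level_notMem (hD : IsGeneric Γ D) (h0 : P0 Γ γ) {p q : W}
    (hp : p ∉ desc D q) (N : ℕ) : ∃ y ∈ level D N p, y ∉ desc D q := by
  by_contra! hcon
  refine hp ((hD.inCBar q).1.mem_of_finite p (((Set.finite_lt_nat N).biUnion
    fun n _ => hD.level_finite h0 p n).subset ?_))
  rintro z ⟨hz, hzq⟩
  obtain ⟨k, hk⟩ := mem_desc.1 hz
  refine Set.mem_biUnion (x := k) ?_ hk
  by_contra hkN
  obtain ⟨j, rfl⟩ := Nat.exists_eq_add_of_le (not_lt.1 hkN)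
  obtain ⟨y, hy, hyz⟩ := mem_level_add.1 hk
  exact hzq (desc_subset_desc (hcon y hy) (level_subset_desc _ _ hyz))

/-- A sequence `c 0 = p`, `c 1 = q`, `c (i + 1) = g i (c i)` with `g i` fixing `c (i - 1)` that ends
in two vertices with disjoint descendant sets. -/
def SeparatingChain (D : Digraph W) (r : ℕ) (p q : W) : Prop :=
  ∃ (g : ℕ → Aut D) (c : ℕ → W), c 0 = p ∧ c 1 = q ∧
    (∀ i : ℕ, 1 ≤ i → i ≤ r → c (i + 1) = g i (c i) ∧ g i (c (i - 1)) = c (i - 1)) ∧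
    Disjoint (desc D (c r)) (desc D (c (r + 1)))

theorem SeparatingChain.cons {r : ℕ} {p q : W} (g : Aut D) (hgp : g p = p)
    (h : SeparatingChain D r q (g q)) : SeparatingChain D (r + 1) p q := by
  obtain ⟨g', c, hc0, hc1, hc, hdisj⟩ := h
  refine ⟨fun i => if i ≤ 1 then g else g' (i - 1), fun i => Nat.casesOn i p c, rfl, hc0, ?_,
    hdisj⟩
  rintro (_ | _ | i) hi hir
  · omega
  · exact ⟨by simp [hc0, hc1], by simp [hgp]⟩
  · simpa using hc (i + 1) (by omega) (by omega)

theorem IsGeneric.exists_separatingChain (hD : IsGeneric Γ D) (h0 : P0 Γ γ) (h3 : P3 Γ γ)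
    {N : ℕ} {p q : W} (h : Balanced D N p q) : ∃ r, SeparatingChain D r p q := by
  induction hk : (level D N p ∩ desc D q).ncard using Nat.strong_induction_on generalizing p q with
  | _ k ih =>
    have hfin : (level D N p ∩ desc D q).Finite := (hD.level_finite h0 p N).inter_of_left _
    rcases Set.eq_empty_or_nonempty (level D N p ∩ desc D q) with hempty | ⟨x, hx, hxq⟩
    · exact ⟨0, fun _ => RelIso.refl _, fun i => Nat.casesOn i p fun _ => q, rfl, rfl,
        fun i hi hi' => by omega, hD.disjoint_of_level_inter_eq_empty h0 h hempty⟩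
    · obtain ⟨y, hy, hyq⟩ := hD.exists_mem_level_notMem h0 h.notMem N
      obtain ⟨f, hf, hl, hfp⟩ := hD.exists_emb h0 p
      obtain ⟨x', hx', rfl⟩ : x ∈ f '' level Γ N γ := by rwa [← hl, hfp]
      obtain ⟨y', hy', rfl⟩ : y ∈ f '' level Γ N γ := by rwa [← hl, hfp]
      obtain ⟨ψ, hψ⟩ := h3 N x' hx' y' hy'
      obtain ⟨g, hg, hsub⟩ := hD.exists_aut_desc_inter_subset p q f hf ψ
      have hgp : g p = p := by
        have := hg γ
        rwa [h0.aut_root, hfp] at this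
      have hgy : g (f y') = f x' := hψ ▸ hg x'
      have hlt : (level D N q ∩ desc D (g q)).ncard < k := by
        rw [← hk]
        refine Set.ncard_lt_ncard ⟨fun z hz => ?_, fun hcon => ?_⟩ hfin
        · have hzq := level_subset_desc _ _ hz.1
          exact ⟨(h.level_iff N z (hsub ⟨hzq, hz.2⟩) hzq).2 hz.1, hzq⟩
        · have := (hcon ⟨hx, hxq⟩).2
          rw [← hgy, aut_mem_desc_iff] at this
          exact hyq this
      obtain ⟨r, hr⟩ := ih _ hlt (h.next g hgp hsub) rfl
      exact ⟨r + 1, hr.cons g hgp⟩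

end Generic

end DescDigraph

theorem mainTheorem7 {V : Type u} {W : Type v} (Γ : Digraph V) (γ : V)
    (h0 : DescDigraph.P0 Γ γ) (h1 : DescDigraph.P1 Γ) (h2 : DescDigraph.P2 Γ)
    (h3 : DescDigraph.P3 Γ γ)
    (D : Digraph W) (hD : DescDigraph.IsGeneric Γ D)
    (a b : W) (hne : a ≠ b) (ha : a ∉ DescDigraph.desc D b) (hb : b ∉ DescDigraph.desc D a) :
    ∃ r : ℕ, 1 ≤ r ∧ ∃ (g : ℕ → DescDigraph.Aut D) (c : ℕ → W),
      c 0 = a ∧ c 1 = b ∧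
      (∀ i : ℕ, 1 ≤ i → i ≤ r → c (i + 1) = g i (c i) ∧ g i (c (i - 1)) = c (i - 1)) ∧
      Disjoint (DescDigraph.desc D (c r)) (DescDigraph.desc D (c (r + 1))) := by
  obtain ⟨g, N, hga, hbal⟩ := hD.exists_balanced h0 h1 h3 hb
  obtain ⟨r, hr⟩ := hD.exists_separatingChain h0 h3 hbal
  exact ⟨r + 1, by omega, hr.cons g hga⟩
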